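/- Let $S$ be a locally compact separable metric space with its Borel $\sigma$-algebra, and let $\mathcal M(S)$ be the space of locally finite non-negative Borel measures on $S$, with the vague topology, i.e. the coarsest topology for which $\mu\mapsto\mu f=\int_S f\,d\mu$ is continuous for every bounded non-negative continuous function $f$ on $S$ with relatively compact support. A point process on $S$ is a random element of $\mathcal M(S)$ (with its Borel $\sigma$-algebra) whose values are counting measures, i.e. take values in $\{0,1,2,\dots\}$ on relatively compact Borel sets. Let $(\xi_n)_{n\in\mathbb N}$ and $\xi$ be point processes on $S$, where $\xi$ has finite intensity, i.e. $\mathbb E\,\xi(A)<\infty$ for every relatively compact Borel set $A\subseteq S$, and suppose that $\xi_n\to\xi$ vaguely in distribution, i.e. in distribution as random elements of $\mathcal M(S)$. Let $h$ be a non-negative continuous function on $S$ such that for every $\varepsilon>0$ there is a relatively compact Borel set $K_\varepsilon\subseteq S$ with $$\limsup_{n\to\infty}\ \mathbb E\int_{S\setminus K_\varepsilon}h(x)\,\xi_n(dx)\le\varepsilon .$$ Then $$\mathbb E\,e^{-\xi_n h}\to\mathbb E\,e^{-\xi h}\qquad\text{as } n\to\infty,$$ where $\xi h=\int_S h\,d\xi\in[0,\infty]$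 and $e^{-\infty}=0$. -/

import Mathlib

open MeasureTheory ProbabilityTheory Filter Topology
open scoped ENNReal NNReal CompactlySupported

/-- The space of locally finite non-negative Borel measures on `S`. (On a locally compact space,
locally finite is the same as finite on relatively compact Borel sets.) -/
structure LocallyFiniteMeasure (S : Type*) [TopologicalSpace S] [MeasurableSpace S] where
  toMeasure : Measure S
  isLocallyFinite : IsLocallyFiniteMeasure toMeasure

namespace LocallyFiniteMeasure

/-- The vague topology: the coarsest topology making `μ ↦ ∫ f dμ` continuous for each
non-negative continuous function `f` with compact support (such an `f` is bounded). -/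
noncomputable instance instTopologicalSpace (S : Type*) [TopologicalSpace S] [MeasurableSpace S] :
    TopologicalSpace (LocallyFiniteMeasure S) :=
  ⨅ f : C_c(S, ℝ≥0),
    TopologicalSpace.induced
      (fun μ : LocallyFiniteMeasure S => ∫⁻ x, (f x : ℝ≥0∞) ∂μ.toMeasure) inferInstance

/-- The Borel σ-algebra of the vague topology. -/
noncomputable instance instMeasurableSpace (S : Type*) [TopologicalSpace S] [MeasurableSpace S] :
    MeasurableSpace (LocallyFiniteMeasure S) :=
  borel (LocallyFiniteMeasure S)

instance instBorelSpace (S : Type*) [TopologicalSpace S] [MeasurableSpace S] :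
    BorelSpace (LocallyFiniteMeasure S) :=
  ⟨rfl⟩

/-- `μ` is a counting measure: its value on each relatively compact Borel set is a
non-negative integer. -/
def IsCounting {S : Type*} [TopologicalSpace S] [MeasurableSpace S]
    (μ : LocallyFiniteMeasure S) : Prop :=
  ∀ A : Set S, MeasurableSet A → IsCompact (closure A) → ∃ k : ℕ, μ.toMeasure A = k

end LocallyFiniteMeasure

/-- A point process on `S`: a random element of the space of locally finite measures whose
values are counting measures. -/
structure IsPointProcess {S Ω : Type*} [TopologicalSpace S] [MeasurableSpace S]
    [MeasurableSpace Ω] (ξ : Ω → LocallyFiniteMeasure S) : Prop where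
  measurable : Measurable ξ
  isCounting : ∀ ω, (ξ ω).IsCounting

/-- `ξ` has finite intensity: `E (ξ A) < ∞` for each relatively compact Borel set `A`. -/
def HasFiniteIntensity {S Ω : Type*} [TopologicalSpace S] [MeasurableSpace S]
    [MeasurableSpace Ω] (P : Measure Ω) (ξ : Ω → LocallyFiniteMeasure S) : Prop :=
  ∀ A : Set S, MeasurableSet A → IsCompact (closure A) →
    ∫⁻ ω, (ξ ω).toMeasure A ∂P < ∞

/-- The Laplace functional `E exp (-ξ h)`, where `ξ h = ∫ h dξ ∈ [0, ∞]` and `exp (-∞) = 0`.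
It takes values in `[0, 1]`, here as a subset of `[0, ∞]`; meant for non-negative `h`. -/
noncomputable def laplaceFunctional {S Ω : Type*} [TopologicalSpace S] [MeasurableSpace S]
    [MeasurableSpace Ω] (P : Measure Ω) (ξ : Ω → LocallyFiniteMeasure S) (h : S → ℝ) : ℝ≥0∞ :=
  ∫⁻ ω, EReal.exp (-((∫⁻ x, ENNReal.ofReal (h x) ∂(ξ ω).toMeasure : ℝ≥0∞) : EReal)) ∂P

/-! Truncate `h` to compactly supported continuous `g k ≤ h` with `g k = h` on the `k`-th set of a
compact exhaustion; vague convergence in distribution gives `E exp (-ξₙ g k) → E exp (-ξ g k)` for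
each `k`. Upper bound: `exp (-ξₙ h) ≤ exp (-ξₙ g k)`, so the limsup is at most `E exp (-ξ g k)`,
which tends to `E exp (-ξ h)` as `k → ∞` by dominated convergence. Lower bound: once `g k = h` on
`K`, `ξₙ h` exceeds `ξₙ g k` by at most the integral of `h` over `Kᶜ`. As `exp (-·)` is 1-Lipschitz,
the expectations then differ by at most the expected tail, which is eventually below `ε`. -/

/-- The function `a ↦ exp (-a)` on `[0, ∞]`, with `exp (-∞) = 0`. -/
noncomputable def expNeg (a : ℝ≥0∞) : ℝ≥0∞ := EReal.exp (-(a : EReal))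

lemma expNeg_antitone : Antitone expNeg := fun _ _ hab =>
  EReal.exp_monotone (EReal.neg_le_neg_iff.2 (EReal.coe_ennreal_le_coe_ennreal_iff.2 hab))

lemma continuous_expNeg : Continuous expNeg :=
  ENNReal.continuous_exp.comp (continuous_neg.comp continuous_coe_ennreal_ereal)

lemma expNeg_le_one (a : ℝ≥0∞) : expNeg a ≤ 1 := by
  simp [expNeg, EReal.coe_ennreal_nonneg]

lemma expNeg_top : expNeg ∞ = 0 := by
  simp [expNeg]

lemma expNeg_coe (a : ℝ≥0) : expNeg a = ENNReal.ofReal (Real.exp (-a)) := by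
  have : (-((a : ℝ≥0∞) : EReal)) = ((-(a : ℝ) : ℝ) : EReal) := by
    rw [EReal.coe_neg]; rfl
  rw [expNeg, this, EReal.exp_coe]

/-- `exp (-·)` is `1`-Lipschitz, in a form that makes sense on `[0, ∞]`. -/
lemma expNeg_le_expNeg_add_add (a b : ℝ≥0∞) : expNeg a ≤ expNeg (a + b) + b := by
  induction b with
  | top => simp
  | coe b =>
    induction a with
    | top => simp [expNeg_top]
    | coe a =>
      rw [← ENNReal.coe_add, expNeg_coe, expNeg_coe, ← ENNReal.ofReal_coe_nnreal (p := b),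
        ← ENNReal.ofReal_add (Real.exp_nonneg _) b.coe_nonneg]
      refine ENNReal.ofReal_le_ofReal ?_
      have h1 : Real.exp (-(a : ℝ)) ≤ 1 := Real.exp_le_one_iff.2 (neg_nonpos.2 a.2)
      have h2 : 1 - (b : ℝ) ≤ Real.exp (-(b : ℝ)) := by
        linarith [Real.add_one_le_exp (-(b : ℝ))]
      have h3 : Real.exp (-((a + b : ℝ≥0) : ℝ)) = Real.exp (-(a : ℝ)) * Real.exp (-(b : ℝ)) := by
        rw [← Real.exp_add, NNReal.coe_add, neg_add]
      have h4 := mul_le_mul_of_nonneg_left h2 (Real.exp_nonneg (-(a : ℝ)))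
      have h5 := mul_le_mul_of_nonneg_right h1 b.2
      change Real.exp (-(a : ℝ)) * (b : ℝ) ≤ 1 * (b : ℝ) at h5
      rw [h3]
      change Real.exp (-(a : ℝ)) ≤ Real.exp (-(a : ℝ)) * Real.exp (-(b : ℝ)) + (b : ℝ)
      linarith

lemma laplaceFunctional_eq {S Ω : Type*} [TopologicalSpace S] [MeasurableSpace S]
    [MeasurableSpace Ω] (P : Measure Ω) (ξ : Ω → LocallyFiniteMeasure S) (h : S → ℝ) :
    laplaceFunctional P ξ h
      = ∫⁻ ω, expNeg (∫⁻ x, ENNReal.ofReal (h x) ∂(ξ ω).toMeasure) ∂P := rfl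

lemma LocallyFiniteMeasure.continuous_lintegral {S : Type*} [TopologicalSpace S]
    [MeasurableSpace S] (g : C_c(S, ℝ≥0)) :
    Continuous fun μ : LocallyFiniteMeasure S => ∫⁻ x, (g x : ℝ≥0∞) ∂μ.toMeasure :=
  continuous_iff_le_induced.2 (iInf_le _ g)

/-- Vague convergence in distribution implies convergence of the Laplace functionals of
compactly supported continuous functions. -/
lemma tendsto_lintegral_expNeg {S : Type*} [TopologicalSpace S] [MeasurableSpace S]
    {Ω : ℕ → Type*} [∀ n, MeasurableSpace (Ω n)]
    {P : (n : ℕ) → Measure (Ω n)} [∀ n, IsProbabilityMeasure (P n)]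
    {Ω' : Type*} [MeasurableSpace Ω'] {P' : Measure Ω'} [IsProbabilityMeasure P']
    {ξs : (n : ℕ) → Ω n → LocallyFiniteMeasure S} {ξ : Ω' → LocallyFiniteMeasure S}
    (hconv : TendstoInDistribution ξs atTop ξ P P') (g : C_c(S, ℝ≥0)) :
    Tendsto (fun n => ∫⁻ ω, expNeg (∫⁻ x, (g x : ℝ≥0∞) ∂(ξs n ω).toMeasure) ∂(P n)) atTop
      (𝓝 (∫⁻ ω, expNeg (∫⁻ x, (g x : ℝ≥0∞) ∂(ξ ω).toMeasure) ∂P')) := by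
  have hc : Continuous fun μ : LocallyFiniteMeasure S =>
      expNeg (∫⁻ x, (g x : ℝ≥0∞) ∂μ.toMeasure) :=
    continuous_expNeg.comp (LocallyFiniteMeasure.continuous_lintegral g)
  have hfin (a : ℝ≥0∞) : expNeg a ≠ ∞ := ((expNeg_le_one a).trans_lt ENNReal.one_lt_top).ne
  -- Weak convergence is tested on bounded `ℝ≥0`-valued functions; `toNNReal` loses nothing because
  -- `expNeg ≤ 1`.
  let F : BoundedContinuousFunction (LocallyFiniteMeasure S) ℝ≥0 :=
    BoundedContinuousFunction.mkOfBound
      ⟨fun μ => (expNeg (∫⁻ x, (g x : ℝ≥0∞) ∂μ.toMeasure)).toNNReal,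
        continuous_iff_continuousAt.2 fun μ =>
          (ENNReal.tendsto_toNNReal (hfin _)).comp hc.continuousAt⟩ 1 (by
        intro μ ν
        have hle (a : ℝ≥0∞) : ((expNeg a).toNNReal : ℝ) ∈ Set.Icc (0 : ℝ) 1 :=
          ⟨NNReal.coe_nonneg _, by
            exact_mod_cast ENNReal.toNNReal_mono ENNReal.one_ne_top (expNeg_le_one a)⟩
        exact (Real.dist_le_of_mem_Icc_01 (hle _) (hle _)))
  have hF (μ : LocallyFiniteMeasure S) :
      (F μ : ℝ≥0∞) = expNeg (∫⁻ x, (g x : ℝ≥0∞) ∂μ.toMeasure) :=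
    ENNReal.coe_toNNReal (hfin _)
  have key := ProbabilityMeasure.tendsto_iff_forall_lintegral_tendsto.1 hconv.tendsto F
  simp only [hF, ProbabilityMeasure.coe_mk] at key
  rw [lintegral_map' hc.measurable.aemeasurable hconv.aemeasurable_limit] at key
  refine key.congr fun n => ?_
  exact lintegral_map' hc.measurable.aemeasurable (hconv.forall_aemeasurable n)

/-- A non-negative continuous function dominates a compactly supported one that agrees with it on
a given compact set. -/
lemma exists_compactlySupported_le_eqOn {S : Type*} [TopologicalSpace S] [R1Space S]
    [LocallyCompactSpace S] {h : S → ℝ} (hcont : Continuous h) {C : Set S} (hC : IsCompact C) :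
    ∃ g : C_c(S, ℝ≥0), (∀ x, (g x : ℝ≥0∞) ≤ ENNReal.ofReal (h x)) ∧
      ∀ x ∈ C, (g x : ℝ≥0∞) = ENNReal.ofReal (h x) := by
  obtain ⟨f, hf1, -, hfs, hf01⟩ :=
    exists_continuous_one_zero_of_isCompact hC isClosed_empty (Set.disjoint_empty C)
  refine ⟨⟨⟨fun x => (f x).toNNReal * (h x).toNNReal, by fun_prop⟩, ?_⟩, fun x => ?_,
    fun x hx => ?_⟩
  · exact HasCompactSupport.mul_right (hfs.comp_left (g := Real.toNNReal) Real.toNNReal_zero)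
  · change (((f x).toNNReal * (h x).toNNReal : ℝ≥0) : ℝ≥0∞) ≤ ((h x).toNNReal : ℝ≥0∞)
    exact_mod_cast mul_le_of_le_one_left' (Real.toNNReal_le_one.2 (hf01 x).2)
  · change (((f x).toNNReal * (h x).toNNReal : ℝ≥0) : ℝ≥0∞) = ((h x).toNNReal : ℝ≥0∞)
    simp [hf1 hx]

/-- Fatou bounds the liminf below and domination by `v` bounds the limsup above. Neither
monotonicity in `k` nor a finite integral of `v` is needed. -/
lemma tendsto_lintegral_of_le_of_eventually_eq {S : Type*} [MeasurableSpace S] (μ : Measure S)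
    {u : ℕ → S → ℝ≥0∞} {v : S → ℝ≥0∞} (hu : ∀ k, Measurable (u k)) (hle : ∀ k x, u k x ≤ v x)
    (heq : ∀ x, ∀ᶠ k in atTop, u k x = v x) :
    Tendsto (fun k => ∫⁻ x, u k x ∂μ) atTop (𝓝 (∫⁻ x, v x ∂μ)) := by
  refine tendsto_of_le_liminf_of_limsup_le ?_ ?_
  · refine le_trans (le_of_eq (lintegral_congr fun x => ?_)) (lintegral_liminf_le hu)
    exact (Tendsto.liminf_eq (tendsto_const_nhds.congr' ((heq x).mono fun _ h => h.symm))).symm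
  · exact (limsup_le_limsup (Eventually.of_forall fun k => lintegral_mono (hle k))).trans
      (limsup_const _).le

theorem lemma4p1
    {S : Type*} [MetricSpace S] [LocallyCompactSpace S] [TopologicalSpace.SeparableSpace S]
    [MeasurableSpace S] [BorelSpace S]
    {Ω : ℕ → Type*} [∀ n, MeasurableSpace (Ω n)]
    (P : (n : ℕ) → Measure (Ω n)) [∀ n, IsProbabilityMeasure (P n)]
    {Ω' : Type*} [MeasurableSpace Ω'] (P' : Measure Ω') [IsProbabilityMeasure P']
    (ξs : (n : ℕ) → Ω n → LocallyFiniteMeasure S) (ξ : Ω' → LocallyFiniteMeasure S)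
    (hξs : ∀ n, IsPointProcess (ξs n)) (hξ : IsPointProcess ξ)
    (hfin : HasFiniteIntensity P' ξ)
    (hconv : TendstoInDistribution ξs atTop ξ P P')
    (h : S → ℝ) (hcont : Continuous h) (hnonneg : ∀ x, 0 ≤ h x)
    (htail : ∀ ε : ℝ, 0 < ε → ∃ K : Set S, MeasurableSet K ∧ IsCompact (closure K) ∧
      limsup (fun n => ∫⁻ ω, ∫⁻ x in Kᶜ, ENNReal.ofReal (h x) ∂(ξs n ω).toMeasure ∂(P n)) atTop
        ≤ ENNReal.ofReal ε) :
    Tendsto (fun n => laplaceFunctional (P n) (ξs n) h) atTop (𝓝 (laplaceFunctional P' ξ h)) := by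
  have : SecondCountableTopology S := UniformSpace.secondCountable_of_separable S
  let C : CompactExhaustion S := CompactExhaustion.choice S
  choose g hgle hgeq using fun k => exists_compactlySupported_le_eqOn hcont (C.isCompact k)
  have hgm (k : ℕ) : Measurable fun x => (g k x : ℝ≥0∞) :=
    (ENNReal.continuous_coe.comp (g k).continuous).measurable
  have hlim (μ : Measure S) : Tendsto (fun k => ∫⁻ x, (g k x : ℝ≥0∞) ∂μ) atTop
      (𝓝 (∫⁻ x, ENNReal.ofReal (h x) ∂μ)) := by
    refine tendsto_lintegral_of_le_of_eventually_eq μ hgm hgle fun x => ?_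
    obtain ⟨k, hk⟩ := C.exists_mem x
    exact (eventually_ge_atTop k).mono fun j hj => hgeq j x (C.subset hj hk)
  have hmeasg (k : ℕ) : Measurable fun μ : LocallyFiniteMeasure S =>
      ∫⁻ x, (g k x : ℝ≥0∞) ∂μ.toMeasure :=
    (LocallyFiniteMeasure.continuous_lintegral (g k)).measurable
  -- For `h` without compact support this map need not be continuous, but it is a pointwise limit of
  -- continuous ones.
  have hmeash : Measurable fun μ : LocallyFiniteMeasure S =>
      ∫⁻ x, ENNReal.ofReal (h x) ∂μ.toMeasure :=
    measurable_of_tendsto_metrizable hmeasg (tendsto_pi_nhds.2 fun μ => hlim μ.toMeasure)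
  have hLlim : Tendsto (fun k => ∫⁻ ω, expNeg (∫⁻ x, (g k x : ℝ≥0∞) ∂(ξ ω).toMeasure) ∂P') atTop
      (𝓝 (laplaceFunctional P' ξ h)) := by
    refine tendsto_lintegral_of_dominated_convergence (fun _ => 1)
      (fun k => continuous_expNeg.measurable.comp ((hmeasg k).comp hξ.measurable))
      (fun k => ae_of_all _ fun ω => expNeg_le_one _) (by simp) (ae_of_all _ fun ω => ?_)
    exact (continuous_expNeg.tendsto _).comp (hlim _)
  have hle (k : ℕ) (μ : Measure S) : expNeg (∫⁻ x, ENNReal.ofReal (h x) ∂μ)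
      ≤ expNeg (∫⁻ x, (g k x : ℝ≥0∞) ∂μ) := expNeg_antitone (lintegral_mono (hgle k))
  refine tendsto_of_le_liminf_of_limsup_le ?_ ?_
  · refine ENNReal.le_of_forall_pos_le_add fun ε hε _ => ?_
    -- Halving `ε` turns the bound on the limsup into a strict one, hence into an eventual bound by
    -- `ε`.
    obtain ⟨K, hKm, hK, hKε⟩ := htail (ε / 2) (by positivity)
    have hev : ∀ᶠ n in atTop,
        ∫⁻ ω, ∫⁻ x in Kᶜ, ENNReal.ofReal (h x) ∂(ξs n ω).toMeasure ∂(P n) < ε := by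
      refine eventually_lt_of_limsup_lt (hKε.trans_lt ?_)
      rw [← ENNReal.ofReal_coe_nnreal]
      exact (ENNReal.ofReal_lt_ofReal_iff (by positivity)).2 (half_lt_self (by positivity))
    obtain ⟨k, hk⟩ := C.exists_superset_of_isCompact hK
    -- With `ε` subtracted on the left, that side is bounded by the limit of a convergent sequence,
    -- which can be compared termwise.
    rw [← tsub_le_iff_right]
    have hsub := ENNReal.Tendsto.sub (tendsto_lintegral_expNeg hconv (g k))
      (tendsto_const_nhds (x := (ε : ℝ≥0∞))) (Or.inr ENNReal.coe_ne_top)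
    refine (tsub_le_tsub_right (lintegral_mono fun ω => hle k (ξ ω).toMeasure) _).trans ?_
    rw [← hsub.liminf_eq]
    refine liminf_le_liminf (hev.mono fun n hn => ?_)
    rw [tsub_le_iff_right]
    calc ∫⁻ ω, expNeg (∫⁻ x, (g k x : ℝ≥0∞) ∂(ξs n ω).toMeasure) ∂(P n)
        ≤ ∫⁻ ω, (expNeg (∫⁻ x, ENNReal.ofReal (h x) ∂(ξs n ω).toMeasure)
            + ∫⁻ x in Kᶜ, ENNReal.ofReal (h x) ∂(ξs n ω).toMeasure) ∂(P n) := by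
          refine lintegral_mono fun ω => (expNeg_le_expNeg_add_add _ _).trans
            (add_le_add_left (expNeg_antitone ?_) _)
          -- Split `∫ h` over `K` and `Kᶜ`: on `K` replace `h` by `g k`, then enlarge the domain to
          -- all of `S`.
          rw [← lintegral_add_compl (fun x => ENNReal.ofReal (h x)) hKm]
          refine add_le_add ?_ le_rfl
          refine (setLIntegral_congr_fun hKm fun x hx => ?_).trans_le
            (setLIntegral_le_lintegral K _)
          exact (hgeq k x (hk (subset_closure hx))).symm
      _ = laplaceFunctional (P n) (ξs n) h
            + ∫⁻ ω, ∫⁻ x in Kᶜ, ENNReal.ofReal (h x) ∂(ξs n ω).toMeasure ∂(P n) :=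
          lintegral_add_left
            (continuous_expNeg.measurable.comp (hmeash.comp (hξs n).measurable)) _
      _ ≤ laplaceFunctional (P n) (ξs n) h + ε := by gcongr
  · refine ge_of_tendsto' hLlim fun k => ?_
    rw [← (tendsto_lintegral_expNeg hconv (g k)).limsup_eq]
    exact limsup_le_limsup (Eventually.of_forall fun n =>
      lintegral_mono fun ω => hle k (ξs n ω).toMeasure)
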